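/- For real $x\ge 1$ let $\mathcal F_1=\mathcal F_1(x)$ be the finite space of completely multiplicative functions $f:\mathbb N\to\{-1,1\}$ determined by the signs $f(p)=\pm1$ at the primes $p\le x$ (only the values $f(n)$ with $n\le x$ matter, and for definiteness $f(p)=1$ for primes $p>x$), and let $\mu$ be the normalized counting measure on $\mathcal F_1$, so that each of the $2^{\pi(x)}$ choices of signs has mass $2^{-\pi(x)}$. Let $\{t\}$ denote the fractional part of $t$. Then for every $c>0$ there exist a constant $C>0$ and a real number $x_0$, both depending only on $c$, such that for all $x\ge x_0$ and all $M\ge c$ $$\mu\left(\left\{f\in\mathcal F_1:\ \left|\sum_{n\le x}\left\{\frac{x}{n}\right\}f(n)\right|\ge \frac{M}{\log x}\,x\right\}\right)\le \exp\left(-\exp\left(\frac{(\log\log\log x)\,\log x}{C\log\log x}\right)\right).$$ -/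

import Mathlib

/-- The space of completely multiplicative functions `f : ℕ → {-1, 1}` determined by the signs
`f p = ±1` at the primes `p ≤ x`.  Only the values `f n` with `n ≤ x` matter; in order to count each
choice of signs exactly once, a function is represented by its extension with `f p = 1` at all
primes `p > x`.  (As a map `ℕ →*₀ ℝ`, `f` has `f 0 = 0`, `f 1 = 1`, `f (m * n) = f m * f n`.) -/
def multSpace (x : ℝ) : Set (ℕ →*₀ ℝ) :=
  {f | (∀ p : ℕ, p.Prime → (p : ℝ) ≤ x → f p = 1 ∨ f p = -1) ∧
       (∀ p : ℕ, p.Prime → x < (p : ℝ) → f p = 1)}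

/-- The normalized counting measure on `multSpace x`: the proportion of `f` in the space which
satisfy `P`. -/
noncomputable def proportion (x : ℝ) (P : (ℕ →*₀ ℝ) → Prop) : ℝ :=
  ({f ∈ multSpace x | P f}.ncard : ℝ) / ((multSpace x).ncard : ℝ)

/-- The sum `∑_{n ≤ x} {x / n} f(n)`, with `{t}` the fractional part of `t`. -/
noncomputable def fracSum (x : ℝ) (f : ℕ →*₀ ℝ) : ℝ :=
  ∑ n ∈ Finset.Icc 1 ⌊x⌋₊, Int.fract (x / (n : ℝ)) * f n

/-- The space is finite, so that `Set.ncard` is its genuine number of elements. -/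
theorem multSpace_finite (x : ℝ) : (multSpace x).Finite := by
  have hS : (Set.univ.pi fun _ : Fin (⌊x⌋₊ + 1) => ({0, 1, -1} : Set ℝ)).Finite :=
    Set.Finite.pi fun _ => Set.toFinite _
  refine Set.Finite.of_finite_image (f := fun g (i : Fin (⌊x⌋₊ + 1)) =>
    if (i : ℕ).Prime then g (i : ℕ) else 0) (hS.subset ?_) ?_
  · rintro _ ⟨f, hf, rfl⟩ i -
    by_cases hi : (i : ℕ).Prime
    · rcases le_or_gt ((i : ℕ) : ℝ) x with h | h
      · rcases hf.1 _ hi h with h | h <;> simp [hi, h]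
      · simp [hi, hf.2 _ hi h]
    · simp [hi]
  · intro f hf g hg h
    have key : ∀ p : ℕ, p.Prime → f p = g p := by
      intro p hp
      rcases le_or_gt (p : ℝ) x with hx | hx
      · have := congrFun h ⟨p, Nat.lt_succ_of_le (Nat.le_floor hx)⟩
        simpa [hp] using this
      · rw [hf.2 p hp hx, hg.2 p hp hx]
    ext n
    induction n using Nat.recOnMul with
    | zero => simp
    | one => simp
    | prime p hp => exact key p hp
    | mul a b ha hb =>
      rcases Nat.eq_zero_or_pos a with rfl | ha'
      · simp
      rcases Nat.eq_zero_or_pos b with rfl | hb'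
      · simp
      rw [map_mul, map_mul]
      grind

/-- The space is nonempty, so that the proportion is not a quotient by zero. -/
theorem multSpace_nonempty (x : ℝ) : (multSpace x).Nonempty := by
  classical
  refine ⟨⟨⟨fun n => if n = 0 then 0 else 1, by simp⟩, by simp, fun a b => ?_⟩, ?_, ?_⟩
  · by_cases ha : a = 0 <;> by_cases hb : b = 0 <;> simp [ha, hb]
  · intro p hp _
    exact Or.inl (if_neg hp.ne_zero)
  · intro p hp _
    exact if_neg hp.ne_zero

/-! Fix the signs at the primes up to a cutoff `n` and use only the randomness of the signs at the
primes in `(n, x]`. Flipping the sign at `p` affects only multiples of `p`, so it moves the sum by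
at most `2 * x / p`. Since the squares `(x / p) ^ 2` over `p > n` add up to `O(x ^ 2 / n)`,
McDiarmid's inequality gives Gaussian concentration around the conditional mean at scale `x / √n`.

The conditional mean is small. An integer `k ≤ x` contributes only if every prime above `n` divides
it to an even power, so either `k` has no prime factor above `n` or it is divisible by `q ^ 2` for
some prime `q > n`. The second kind number `O(x / n)`; the first are counted by Rankin's method,
which needs only Chebyshev-strength bounds for sums over primes.

Write `L`, `L2`, `L3` for the iterated logarithms of `x`. Rankin's bound is `x / L ^ 4` for cutoffs
up to `exp (L3 * L / (160 * L2))`, so half of the threshold `c * x / L` covers the mean and the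
other half is a deviation. Its probability is about `exp (-c ^ 2 * n / (16 * L ^ 2))`, doubly
exponentially small for the largest allowed `n`. The fractional parts enter only through lying in
`[0, 1)`. -/

/-! ### Mertens-type upper bounds for sums over primes. -/

/-- Sum over `m ≤ n` the inequality `∑ log p ≤ log m`, taken over the primes `p ∣ m`, and exchange
the sums. Replacing `⌊n / p⌋` by `n / p` costs `θ(n) ≤ n * log 4`. -/
theorem sum_primesLE_log_div_le {n : ℕ} (hn : 1 ≤ n) :
    ∑ p ∈ Nat.primesLE n, Real.log p / p ≤ Real.log n + Real.log 4 := by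
  have hn' : (0 : ℝ) < n := by exact_mod_cast hn
  have h1 : ∑ p ∈ Nat.primesLE n, ((n / p : ℕ) : ℝ) * Real.log p ≤ n * Real.log n := by
    calc ∑ p ∈ Nat.primesLE n, ((n / p : ℕ) : ℝ) * Real.log p
        = ∑ p ∈ Nat.primesLE n, ∑ m ∈ Finset.Ioc 0 n, if p ∣ m then Real.log p else 0 := by
          refine Finset.sum_congr rfl fun p _ => ?_
          rw [← Finset.sum_filter, Finset.sum_const, Nat.Ioc_filter_dvd_card_eq_div, nsmul_eq_mul]
      _ = ∑ m ∈ Finset.Ioc 0 n, ∑ p ∈ Nat.primesLE n, if p ∣ m then Real.log p else 0 :=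
          Finset.sum_comm
      _ ≤ ∑ m ∈ Finset.Ioc 0 n, Real.log n := by
          refine Finset.sum_le_sum fun m hm => ?_
          obtain ⟨hm0, hmn⟩ := Finset.mem_Ioc.1 hm
          rw [← Finset.sum_filter]
          calc ∑ p ∈ (Nat.primesLE n).filter (· ∣ m), Real.log p
              ≤ ∑ p ∈ m.primeFactors, Real.log p := by
                refine Finset.sum_le_sum_of_subset_of_nonneg ?_
                  fun p _ _ => Real.log_natCast_nonneg p
                intro p hp
                obtain ⟨hp1, hp2⟩ := Finset.mem_filter.1 hp
                exact Nat.mem_primeFactors.2 ⟨(Nat.mem_primesLE.1 hp1).2, hp2, hm0.ne'⟩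
            _ = Real.log ((∏ p ∈ m.primeFactors, p : ℕ) : ℝ) := by
                rw [Nat.cast_prod, Real.log_prod]
                intro p hp
                exact_mod_cast (Nat.prime_of_mem_primeFactors hp).ne_zero
            _ ≤ Real.log n := by
                refine Real.log_le_log ?_ ?_
                · exact_mod_cast Finset.prod_pos fun p hp =>
                    (Nat.prime_of_mem_primeFactors hp).pos
                · exact_mod_cast (Nat.le_of_dvd hm0 (Nat.prod_primeFactors_dvd m)).trans hmn
      _ = n * Real.log n := by simp
  have h2 : ∑ p ∈ Nat.primesLE n, Real.log p ≤ Real.log 4 * n := by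
    rw [← Chebyshev.theta_eq_sum_primesLE_log]
    exact Chebyshev.theta_le_log4_mul_x hn'.le
  have h3 : ∑ p ∈ Nat.primesLE n, (n : ℝ) * (Real.log p / p) ≤
      ∑ p ∈ Nat.primesLE n, (((n / p : ℕ) : ℝ) * Real.log p + Real.log p) := by
    refine Finset.sum_le_sum fun p hp => ?_
    have hp0 : (0 : ℝ) < p := by exact_mod_cast (Nat.mem_primesLE.1 hp).2.pos
    have : (n : ℝ) / p ≤ ((n / p : ℕ) : ℝ) + 1 := by
      rw [← Nat.floor_div_eq_div (K := ℝ)]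
      exact (Nat.lt_floor_add_one _).le
    calc (n : ℝ) * (Real.log p / p) = (n : ℝ) / p * Real.log p := by ring
      _ ≤ (((n / p : ℕ) : ℝ) + 1) * Real.log p := by
          gcongr
      _ = _ := by ring
  rw [← Finset.mul_sum, Finset.sum_add_distrib] at h3
  refine le_of_mul_le_mul_left ?_ hn'
  linarith

/-- On the block `(2 ^ 2 ^ k, 2 ^ 2 ^ (k + 1)]` one has `log p ≥ 2 ^ k * log 2`, so dividing the
bound for `∑ log p / p` by this shows that each block contributes at most 4. -/
theorem sum_primesLE_two_pow_two_pow_inv_le (k : ℕ) :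
    ∑ p ∈ Nat.primesLE (2 ^ 2 ^ k), (1 : ℝ) / p ≤ 1 + 4 * k := by
  induction k with
  | zero =>
    have : Nat.primesLE (2 ^ 2 ^ 0) = {2} := by decide
    rw [this]
    norm_num
  | succ k ih =>
    have hsub : Nat.primesLE (2 ^ 2 ^ k) ⊆ Nat.primesLE (2 ^ 2 ^ (k + 1)) := by
      intro p hp
      rw [Nat.mem_primesLE] at hp ⊢
      exact ⟨hp.1.trans (Nat.pow_le_pow_right two_pos
        (Nat.pow_le_pow_right two_pos k.le_succ)), hp.2⟩
    have hl2 := Real.log_pos one_lt_two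
    have hlog : ∀ j : ℕ, Real.log ((2 ^ 2 ^ j : ℕ) : ℝ) = 2 ^ j * Real.log 2 := by
      intro j
      push_cast
      rw [Real.log_pow]
      push_cast
      rfl
    have hk : (1 : ℝ) ≤ 2 ^ k := one_le_pow₀ one_le_two
    have hpos : 0 < 2 ^ k * Real.log 2 := by positivity
    have hblock : ∑ p ∈ Nat.primesLE (2 ^ 2 ^ (k + 1)) \ Nat.primesLE (2 ^ 2 ^ k), (1 : ℝ) / p
        ≤ 4 := by
      refine le_of_mul_le_mul_left ?_ hpos
      rw [Finset.mul_sum]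
      calc ∑ p ∈ Nat.primesLE (2 ^ 2 ^ (k + 1)) \ Nat.primesLE (2 ^ 2 ^ k),
            2 ^ k * Real.log 2 * ((1 : ℝ) / p)
          ≤ ∑ p ∈ Nat.primesLE (2 ^ 2 ^ (k + 1)) \ Nat.primesLE (2 ^ 2 ^ k),
            Real.log p / p := by
            refine Finset.sum_le_sum fun p hp => ?_
            rw [Finset.mem_sdiff, Nat.mem_primesLE, Nat.mem_primesLE] at hp
            have hlt : 2 ^ 2 ^ k < p := by
              by_contra h
              exact hp.2 ⟨not_lt.1 h, hp.1.2⟩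
            rw [mul_one_div]
            gcongr
            rw [← hlog]
            exact Real.log_le_log (by positivity) (by exact_mod_cast hlt.le)
        _ ≤ ∑ p ∈ Nat.primesLE (2 ^ 2 ^ (k + 1)), Real.log p / p :=
            Finset.sum_le_sum_of_subset_of_nonneg Finset.sdiff_subset fun p _ _ =>
              div_nonneg (Real.log_natCast_nonneg p) p.cast_nonneg
        _ ≤ _ := sum_primesLE_log_div_le Nat.one_le_two_pow
        _ ≤ _ := by
            have h4 : Real.log 4 = 2 * Real.log 2 := by
              rw [show (4 : ℝ) = 2 ^ 2 by norm_num, Real.log_pow]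
              norm_num
            rw [hlog, h4, pow_succ]
            nlinarith
    rw [← Finset.sum_sdiff hsub]
    push_cast
    linarith

theorem sum_primesLE_inv_le {x : ℝ} (hx : Real.exp 1 ≤ x) {n : ℕ} (hn : (n : ℝ) ≤ x) :
    ∑ p ∈ Nat.primesLE n, (1 : ℝ) / p ≤ 8 * Real.log (Real.log x) + 9 := by
  have hx0 : 0 < x := (Real.exp_pos 1).trans_le hx
  have hL : 1 ≤ Real.log x := (Real.le_log_iff_exp_le hx0).2 hx
  have hLL : 0 ≤ Real.log (Real.log x) := Real.log_nonneg hL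
  have hl2 : (0.69 : ℝ) < Real.log 2 := by linarith [Real.log_two_gt_d9]
  -- The factor 2 exceeds `1 / log 2`, and the extra 1 pays for `-log (log 2) ≤ log 2`; together
  -- they give `x ≤ 2 ^ 2 ^ k`.
  obtain ⟨k, hk⟩ : ∃ k : ℕ, k = ⌈2 * Real.log (Real.log x) + 1⌉₊ := ⟨_, rfl⟩
  have hk1 : 2 * Real.log (Real.log x) + 1 ≤ k := hk ▸ Nat.le_ceil _
  have hk2 : (k : ℝ) < 2 * Real.log (Real.log x) + 1 + 1 :=
    hk ▸ Nat.ceil_lt_add_one (by linarith)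
  have hn2 : n ≤ 2 ^ 2 ^ k := by
    have h1 : Real.log x ≤ 2 ^ k * Real.log 2 := by
      rw [← Real.log_le_log_iff (by linarith) (by positivity),
        Real.log_mul (by positivity) (by positivity), Real.log_pow]
      have : -Real.log 2 ≤ Real.log (Real.log 2) := by
        rw [← Real.log_inv]
        refine Real.log_le_log (by norm_num) (by linarith)
      nlinarith
    have h2 : x ≤ 2 ^ 2 ^ k := by
      rw [← Real.log_le_log_iff hx0 (by positivity), Real.log_pow]
      exact_mod_cast h1
    exact_mod_cast hn.trans h2
  calc ∑ p ∈ Nat.primesLE n, (1 : ℝ) / p ≤ ∑ p ∈ Nat.primesLE (2 ^ 2 ^ k), (1 : ℝ) / p := by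
        refine Finset.sum_le_sum_of_subset_of_nonneg ?_ fun p _ _ => by positivity
        intro p hp
        rw [Nat.mem_primesLE] at hp ⊢
        exact ⟨hp.1.trans hn2, hp.2⟩
    _ ≤ 1 + 4 * k := sum_primesLE_two_pow_two_pow_inv_le k
    _ ≤ _ := by linarith

/-! ### Smooth numbers by Rankin's method. -/

/-- Rankin's upper bound for the number of smooth numbers. -/
theorem card_smoothNumbers_le {x η : ℝ} (hx : 0 < x) (hη : η ≤ 1 / 2) (N : ℕ) :
    (((Finset.Icc 1 ⌊x⌋₊).filter (· ∈ Nat.smoothNumbers N)).card : ℝ) ≤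
      x ^ (1 - η) * Real.exp (4 * ∑ p ∈ Nat.primesBelow N, (p : ℝ) ^ (η - 1)) := by
  let g : ℕ →* ℝ :=
    { toFun := fun n => (n : ℝ) ^ (η - 1)
      map_one' := by simp
      map_mul' := fun a b => by
        push_cast
        exact Real.mul_rpow a.cast_nonneg b.cast_nonneg }
  have hg : ∀ n : ℕ, g n = (n : ℝ) ^ (η - 1) := fun _ => rfl
  have hg0 : ∀ n : ℕ, 0 ≤ g n := fun n => Real.rpow_nonneg n.cast_nonneg _
  have hprime : ∀ p : ℕ, p.Prime → g p ≤ 3 / 4 := by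
    intro p hp
    have h2 : (2 : ℝ) ≤ p := by exact_mod_cast hp.two_le
    calc (p : ℝ) ^ (η - 1) ≤ (p : ℝ) ^ (-(1 / 2) : ℝ) :=
          Real.rpow_le_rpow_of_exponent_le (by linarith) (by linarith)
      _ ≤ (2 : ℝ) ^ (-(1 / 2) : ℝ) :=
          Real.rpow_le_rpow_of_nonpos (by norm_num) h2 (by norm_num)
      _ ≤ 3 / 4 := by
          rw [Real.rpow_neg (by norm_num), ← Real.sqrt_eq_rpow]
          refine inv_le_of_inv_le₀ (by norm_num) ?_
          exact Real.le_sqrt_of_sq_le (by norm_num)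
  obtain ⟨-, hs⟩ := EulerProduct.summable_and_hasSum_smoothNumbers_prod_primesBelow_geometric
    (f := g) (fun {p} hp => by
      rw [Real.norm_of_nonneg (hg0 p)]
      linarith [hprime p hp]) N
  have hprod : ∏ p ∈ Nat.primesBelow N, (1 - g p)⁻¹ ≤
      Real.exp (4 * ∑ p ∈ Nat.primesBelow N, (p : ℝ) ^ (η - 1)) := by
    rw [Finset.mul_sum, Real.exp_sum]
    refine Finset.prod_le_prod (fun p hp => ?_) fun p hp => ?_
    · have := hprime p (Nat.prime_of_mem_primesBelow hp)
      exact inv_nonneg.2 (by linarith)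
    -- For `0 ≤ u ≤ 3 / 4`, `(1 - u) * (1 + 4 * u) ≥ 1`, hence `(1 - u)⁻¹ ≤ exp (4 * u)`.
    · have h1 := hprime p (Nat.prime_of_mem_primesBelow hp)
      have h0 := hg0 p
      rw [← hg, inv_le_iff_one_le_mul₀ (by linarith)]
      have := Real.add_one_le_exp (4 * g p)
      nlinarith
  refine le_trans ?_ (mul_le_mul_of_nonneg_left hprod (Real.rpow_nonneg hx.le _))
  set S := (Finset.Icc 1 ⌊x⌋₊).filter (· ∈ Nat.smoothNumbers N)
  have hS : ∑ n ∈ S, g n ≤ ∏ p ∈ Nat.primesBelow N, (1 - g p)⁻¹ := by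
    rw [← Finset.sum_subtype_of_mem (p := (· ∈ Nat.smoothNumbers N)) g
      fun n hn => (Finset.mem_filter.1 hn).2]
    exact sum_le_hasSum _ (fun i _ => hg0 i) hs
  refine le_trans ?_ (mul_le_mul_of_nonneg_left hS (Real.rpow_nonneg hx.le _))
  rw [Finset.mul_sum, Finset.card_eq_sum_ones, Nat.cast_sum]
  refine Finset.sum_le_sum fun n hn => ?_
  obtain ⟨h1, h2⟩ := Finset.mem_Icc.1 (Finset.mem_filter.1 hn).1
  have hn0 : (0 : ℝ) < n := by exact_mod_cast h1
  have hnx : (n : ℝ) ≤ x := (Nat.le_floor_iff hx.le).1 h2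
  rw [hg, show η - 1 = -(1 - η) by ring, Real.rpow_neg hn0.le, Nat.cast_one,
    ← div_eq_mul_inv, one_le_div (by positivity)]
  exact Real.rpow_le_rpow hn0.le hnx (by linarith)

/-- This is `exp v ≤ 1 + v * exp v` with `v = η * log p`, followed by `p ^ η ≤ n ^ η` and the bound
for `∑ log p / p`. -/
theorem sum_primesLE_rpow_sub_one_le {η : ℝ} (hη : 0 ≤ η) {n : ℕ} (hn : 1 ≤ n) :
    ∑ p ∈ Nat.primesLE n, (p : ℝ) ^ (η - 1) ≤
      ∑ p ∈ Nat.primesLE n, (1 : ℝ) / p +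
        η * (n : ℝ) ^ η * (Real.log n + Real.log 4) := by
  refine le_trans ?_ (add_le_add_right (mul_le_mul_of_nonneg_left (sum_primesLE_log_div_le hn)
    (by positivity)) _)
  rw [Finset.mul_sum, ← Finset.sum_add_distrib]
  refine Finset.sum_le_sum fun p hp => ?_
  obtain ⟨hpn, hp⟩ := Nat.mem_primesLE.1 hp
  have hp0 : (0 : ℝ) < p := by exact_mod_cast hp.pos
  have hlog := Real.log_natCast_nonneg p
  have h1 : (p : ℝ) ^ η ≤ 1 + η * (p : ℝ) ^ η * Real.log p := by
    have h := Real.add_one_le_exp (-(Real.log p * η))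
    rw [Real.rpow_def_of_pos hp0]
    have h' := mul_le_mul_of_nonneg_left h (Real.exp_pos (Real.log p * η)).le
    rw [← Real.exp_add, add_neg_cancel, Real.exp_zero] at h'
    linarith
  have h2 : (p : ℝ) ^ η ≤ (n : ℝ) ^ η :=
    Real.rpow_le_rpow hp0.le (by exact_mod_cast hpn) hη
  rw [Real.rpow_sub_one hp0.ne', ← mul_div_assoc, ← add_div]
  gcongr
  refine h1.trans ?_
  gcongr

/-- Numbers up to `x` with all prime factors at most
`exp (log x * logloglog x / (160 * loglog x))` are sparse. -/
theorem card_smoothNumbers_le_div_log_pow {x : ℝ} {n : ℕ} (hx : Real.exp 1 ≤ x)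
    (h3 : 1 ≤ Real.log (Real.log (Real.log x)))
    (h160 : 160 * Real.log (Real.log x) ≤ Real.log x) (hn : 1 ≤ n)
    (hny : (n : ℝ) ≤ Real.exp (Real.log (Real.log (Real.log x)) * Real.log x /
      (160 * Real.log (Real.log x)))) :
    (((Finset.Icc 1 ⌊x⌋₊).filter (· ∈ Nat.smoothNumbers (n + 1))).card : ℝ) ≤
      x / Real.log x ^ 4 := by
  have hx0 : 0 < x := (Real.exp_pos 1).trans_le hx
  have hL : 1 ≤ Real.log x := (Real.le_log_iff_exp_le hx0).2 hx
  set L := Real.log x with hLdef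
  have hLpos : 0 < L := by linarith
  have hLL0 : 0 ≤ Real.log L := Real.log_nonneg hL
  set L2 := Real.log L with hL2def
  have hL2pos : 0 < L2 := by
    -- If `L2 = 0`, then `L3` is the default value `log 0 = 0`, contrary to `1 ≤ L3`.
    rcases hLL0.eq_or_lt with h | h
    · rw [← h, Real.log_zero] at h3; linarith
    · exact h
  have hL2one : 1 ≤ L2 := by
    have := Real.log_le_sub_one_of_pos hL2pos
    linarith
  set L3 := Real.log L2 with hL3def
  -- Rankin's saving is `x ^ (-η) = exp (-80 * L2)`. The Euler product costs at most `exp (4 * (8 +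
  -- 9 + 2) * L2) = exp (76 * L2)`, which leaves `L ^ (-4)`. As `160 = 2 * 80`, the size of `n`
  -- gives `η * log n ≤ L3 / 2`, so `n ^ η ≤ √L2`.
  set η := 80 * L2 / L with hηdef
  have hη0 : 0 ≤ η := by positivity
  have hη : η ≤ 1 / 2 := by
    rw [hηdef, div_le_iff₀ hLpos]
    linarith
  have hn0 : (0 : ℝ) < n := by exact_mod_cast hn
  have hlogn : Real.log n ≤ L3 * L / (160 * L2) := (Real.log_le_iff_le_exp hn0).2 hny
  have hηlog : η * (L3 * L / (160 * L2)) = L3 / 2 := by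
    rw [hηdef]
    field_simp
    norm_num
  have hηn : η * Real.log n ≤ L3 / 2 := hηlog ▸ mul_le_mul_of_nonneg_left hlogn hη0
  have hL3half : L3 / 2 = Real.log √L2 := by
    rw [Real.log_sqrt hLL0]
  have hsq : √L2 * √L2 = L2 := Real.mul_self_sqrt hLL0
  have hs1 : 1 ≤ √L2 := Real.one_le_sqrt.2 hL2one
  have hL3s : L3 / 2 ≤ √L2 := by
    rw [hL3half]
    exact Real.log_le_self (by positivity)
  have hnη : (n : ℝ) ^ η ≤ √L2 := by
    rw [Real.rpow_def_of_pos hn0, mul_comm, ← Real.exp_log (show 0 < √L2 by positivity), ← hL3half]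
    exact Real.exp_le_exp.2 hηn
  have hyx : L3 * L / (160 * L2) ≤ L := by
    rw [div_le_iff₀ (by positivity)]
    have : L3 ≤ L2 := Real.log_le_self hLL0
    nlinarith
  have hnx : (n : ℝ) ≤ x := by
    refine hny.trans ?_
    rw [← Real.exp_log hx0]
    exact Real.exp_le_exp.2 hyx
  have hlog4 : Real.log 4 ≤ 2 := by
    rw [show (4 : ℝ) = 2 ^ 2 by norm_num, Real.log_pow]
    have := Real.log_two_lt_d9
    push_cast
    linarith
  have hterm : η * (n : ℝ) ^ η * (Real.log n + Real.log 4) ≤ 2 * L2 := by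
    have h1 : η * (Real.log n + Real.log 4) ≤ √L2 + 1 := by nlinarith
    have h0 : 0 ≤ (n : ℝ) ^ η := by positivity
    calc η * (n : ℝ) ^ η * (Real.log n + Real.log 4)
        = (n : ℝ) ^ η * (η * (Real.log n + Real.log 4)) := by ring
      _ ≤ √L2 * (√L2 + 1) := by
          gcongr
      _ ≤ 2 * L2 := by nlinarith
  have hsum := sum_primesLE_rpow_sub_one_le hη0 hn
  have hinv := sum_primesLE_inv_le hx hnx
  have hexp : 4 * ∑ p ∈ Nat.primesLE n, (p : ℝ) ^ (η - 1) ≤ 76 * L2 := by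
    linarith
  refine (card_smoothNumbers_le hx0 hη (n + 1)).trans ?_
  have hxη : x ^ (1 - η) = x * Real.exp (-(80 * L2)) := by
    rw [Real.rpow_sub hx0, Real.rpow_one, Real.rpow_def_of_pos hx0, Real.exp_neg, div_eq_mul_inv,
      ← hLdef, hηdef]
    congr 3
    field_simp
  have hpow : L ^ 4 = Real.exp (4 * L2) := by
    rw [hL2def, ← Real.exp_log (pow_pos hLpos 4), Real.log_pow]
    norm_num
  rw [hxη, hpow, mul_assoc, ← Real.exp_add, div_eq_mul_inv, ← Real.exp_neg]
  gcongr
  change -(80 * L2) + 4 * ∑ p ∈ Nat.primesLE n, (p : ℝ) ^ (η - 1) ≤ _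
  linarith

/-! ### Bounded differences and conditioning on subsets. -/

/-- If inserting `p ∈ Q` changes `F` by at most `2 * d p`, then the exponential moment of `F` over
the subsets of `Q` is at most that of a Gaussian with the mean of `F` and variance `∑ d p ^ 2`. -/
theorem sum_powerset_exp_le (Q : Finset ℕ) (d : ℕ → ℝ) (F : Finset ℕ → ℝ)
    (hF : ∀ p ∈ Q, ∀ A ⊆ Q, p ∉ A → |F (insert p A) - F A| ≤ 2 * d p) :
    ∑ A ∈ Q.powerset, Real.exp (F A) ≤
      2 ^ Q.card * Real.exp ((∑ A ∈ Q.powerset, F A) / 2 ^ Q.card + (∑ p ∈ Q, d p ^ 2) / 2) := by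
  induction Q using Finset.induction_on generalizing F with
  | empty => simp
  | insert p Q hp ih =>
    -- With mean `u` and half-difference `v`, the pair sums to `2 * exp u * cosh v`, and `cosh v ≤
    -- exp (v ^ 2 / 2)`.
    have hpair : ∀ A ∈ Q.powerset, Real.exp (F A) + Real.exp (F (insert p A)) ≤
        2 * Real.exp (d p ^ 2 / 2) * Real.exp ((F A + F (insert p A)) / 2) := by
      intro A hA
      have hA := Finset.mem_powerset.1 hA
      set u := (F A + F (insert p A)) / 2 with hu
      set v := (F (insert p A) - F A) / 2 with hv
      have hvd : v ^ 2 ≤ d p ^ 2 := by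
        have := hF p (Finset.mem_insert_self p Q) A (hA.trans (Finset.subset_insert p Q))
          fun h => hp (hA h)
        refine sq_le_sq' ?_ ?_ <;> rw [hv] <;> linarith [abs_le.1 this]
      have h1 : F A = u + -v := by rw [hu, hv]; ring
      have h2 : F (insert p A) = u + v := by rw [hu, hv]; ring
      have h3 := Real.cosh_le_exp_half_sq v
      rw [Real.cosh_eq] at h3
      have h4 : Real.exp (v ^ 2 / 2) ≤ Real.exp (d p ^ 2 / 2) := Real.exp_le_exp.2 (by linarith)
      rw [h1, h2, Real.exp_add, Real.exp_add]
      nlinarith [Real.exp_pos u]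
    -- Averaging over the presence of `p` preserves the remaining bounded differences, so the
    -- induction applies to the average.
    have hG : ∀ q ∈ Q, ∀ A ⊆ Q, q ∉ A →
        |(F (insert q A) + F (insert p (insert q A))) / 2 - (F A + F (insert p A)) / 2| ≤
          2 * d q := by
      intro q hq A hA hqA
      have hAp : A ⊆ insert p Q := hA.trans (Finset.subset_insert p Q)
      have h1 := hF q (Finset.mem_insert_of_mem hq) A hAp hqA
      have h2 := hF q (Finset.mem_insert_of_mem hq) (insert p A)
        (Finset.insert_subset_insert p hA) (by
          rw [Finset.mem_insert, not_or]
          exact ⟨fun h => hp (h ▸ hq), hqA⟩)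
      rw [Finset.insert_comm q p] at h2
      rw [abs_le] at h1 h2 ⊢
      constructor <;> linarith
    have key := ih (fun A => (F A + F (insert p A)) / 2) hG
    rw [← Finset.sum_div, Finset.sum_add_distrib] at key
    rw [Finset.sum_powerset_insert hp, Finset.sum_powerset_insert hp, ← Finset.sum_add_distrib,
      Finset.card_insert_of_notMem hp, Finset.sum_insert hp]
    refine (Finset.sum_le_sum hpair).trans ?_
    rw [← Finset.mul_sum]
    refine (mul_le_mul_of_nonneg_left key (by positivity)).trans_eq ?_
    rw [show ∀ a b c : ℝ, 2 * a * (b * c) = b * 2 * (a * c) from fun a b c => by ring,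
      ← pow_succ, ← Real.exp_add]
    congr 2
    rw [pow_succ]
    field_simp
    ring

/-- McDiarmid's inequality for the uniform distribution on the subsets of `Q`. -/
theorem card_filter_powerset_le (Q : Finset ℕ) (d : ℕ → ℝ) (F : Finset ℕ → ℝ)
    (hF : ∀ p ∈ Q, ∀ A ⊆ Q, p ∉ A → |F (insert p A) - F A| ≤ 2 * d p)
    {D m t : ℝ} (hD : 0 < D) (hdD : ∑ p ∈ Q, d p ^ 2 ≤ D) (ht : 0 ≤ t)
    (hm : (∑ A ∈ Q.powerset, F A) / 2 ^ Q.card ≤ m) :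
    ((Q.powerset.filter fun A => m + t ≤ F A).card : ℝ) ≤
      2 ^ Q.card * Real.exp (-(t ^ 2 / (2 * D))) := by
  -- This is the minimizer of the Chernoff exponent `l ^ 2 * D / 2 - l * t`.
  set l := t / D with hl
  have hl0 : 0 ≤ l := by positivity
  have h := sum_powerset_exp_le Q (fun p => l * d p) (fun A => l * F A) (by
    intro p hp A hA hpA
    rw [← mul_sub, abs_mul, abs_of_nonneg hl0]
    nlinarith [hF p hp A hA hpA])
  have h1 : ((Q.powerset.filter fun A => m + t ≤ F A).card : ℝ) * Real.exp (l * (m + t)) ≤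
      ∑ A ∈ Q.powerset, Real.exp (l * F A) := by
    rw [← nsmul_eq_mul, ← Finset.sum_const]
    refine le_trans (Finset.sum_le_sum fun A hA => ?_) (Finset.sum_le_sum_of_subset_of_nonneg
      (Finset.filter_subset (fun A => m + t ≤ F A) _) fun A _ _ => (Real.exp_pos _).le)
    exact Real.exp_le_exp.2 (mul_le_mul_of_nonneg_left (Finset.mem_filter.1 hA).2 hl0)
  have h2 := h1.trans h
  rw [← le_div_iff₀ (Real.exp_pos _), mul_div_assoc, ← Real.exp_sub] at h2
  refine h2.trans ?_
  gcongr
  have e1 : ∑ p ∈ Q, (l * d p) ^ 2 ≤ l ^ 2 * D := by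
    simp_rw [mul_pow]
    rw [← Finset.mul_sum]
    gcongr
  have e2 : (∑ A ∈ Q.powerset, l * F A) / 2 ^ Q.card ≤ l * m := by
    rw [← Finset.mul_sum, mul_div_assoc]
    gcongr
  have e3 : l ^ 2 * D / 2 - l * t = -(t ^ 2 / (2 * D)) := by
    rw [hl]
    field_simp
    ring
  linarith

/-- Two-sided form of McDiarmid's inequality. -/
theorem card_filter_powerset_abs_le (Q : Finset ℕ) (d : ℕ → ℝ) (F : Finset ℕ → ℝ)
    (hF : ∀ p ∈ Q, ∀ A ⊆ Q, p ∉ A → |F (insert p A) - F A| ≤ 2 * d p)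
    {D m t : ℝ} (hD : 0 < D) (hdD : ∑ p ∈ Q, d p ^ 2 ≤ D) (ht : 0 ≤ t)
    (hm : |∑ A ∈ Q.powerset, F A| ≤ 2 ^ Q.card * m) :
    ((Q.powerset.filter fun A => m + t ≤ |F A|).card : ℝ) ≤
      2 ^ Q.card * (2 * Real.exp (-(t ^ 2 / (2 * D)))) := by
  have hm' := abs_le.1 hm
  have h1 := card_filter_powerset_le Q d F hF hD hdD ht (m := m)
    ((div_le_iff₀' (by positivity)).2 hm'.2)
  have h2 := card_filter_powerset_le Q d (fun A => -F A) (fun p hp A hA hpA => by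
      rw [← neg_sub', abs_neg]
      exact hF p hp A hA hpA) hD hdD ht (m := m)
    ((div_le_iff₀' (by positivity)).2 (by rw [Finset.sum_neg_distrib]; linarith))
  have h3 : (Q.powerset.filter fun A => m + t ≤ |F A|) ⊆
      (Q.powerset.filter fun A => m + t ≤ F A) ∪ Q.powerset.filter fun A => m + t ≤ -F A := by
    intro A hA
    rw [← Finset.filter_or]
    obtain ⟨hA1, hA2⟩ := Finset.mem_filter.1 hA
    exact Finset.mem_filter.2 ⟨hA1, le_abs.1 hA2⟩
  have h4 : ((Q.powerset.filter fun A => m + t ≤ |F A|).card : ℝ) ≤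
      ((Q.powerset.filter fun A => m + t ≤ F A).card : ℝ) +
        (Q.powerset.filter fun A => m + t ≤ -F A).card := by
    exact_mod_cast (Finset.card_le_card h3).trans (Finset.card_union_le _ _)
  linarith

/-- The subsets of a disjoint union are counted by conditioning on their trace on one part. -/
theorem card_filter_powerset_union {R Q : Finset ℕ} (h : Disjoint R Q)
    (P : Finset ℕ → Prop) [DecidablePred P] :
    ((R ∪ Q).powerset.filter P).card =
      ∑ B ∈ R.powerset, (Q.powerset.filter fun A => P (B ∪ A)).card := by
  rw [← Finset.card_sigma]
  symm
  refine Finset.card_nbij' (fun s => s.1 ∪ s.2) (fun A => ⟨A ∩ R, A ∩ Q⟩) ?_ ?_ ?_ ?_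
  · rintro ⟨B, A⟩ hs
    simp only [Finset.coe_sigma, Set.mem_sigma_iff, Finset.mem_coe, Finset.mem_powerset,
      Finset.mem_filter] at hs ⊢
    exact ⟨Finset.union_subset_union hs.1 hs.2.1, hs.2.2⟩
  · intro A hA
    obtain ⟨hA1, hA2⟩ := Finset.mem_filter.1 hA
    have hA1 := Finset.mem_powerset.1 hA1
    simp only [Finset.coe_sigma, Set.mem_sigma_iff, Finset.mem_coe, Finset.mem_powerset,
      Finset.mem_filter]
    refine ⟨Finset.inter_subset_right, Finset.inter_subset_right, ?_⟩
    rwa [← Finset.inter_union_distrib_left, Finset.inter_eq_left.2 hA1]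
  · rintro ⟨B, A⟩ hs
    simp only [Finset.coe_sigma, Set.mem_sigma_iff, Finset.mem_coe, Finset.mem_powerset,
      Finset.mem_filter] at hs
    have h1 : (B ∪ A) ∩ R = B := by
      ext a
      have : a ∈ R → a ∉ Q := fun ha => Finset.disjoint_left.1 h ha
      have : a ∈ B → a ∈ R := fun ha => hs.1 ha
      have : a ∈ A → a ∈ Q := fun ha => hs.2.1 ha
      simp only [Finset.mem_inter, Finset.mem_union]
      tauto
    have h2 : (B ∪ A) ∩ Q = A := by
      ext a
      have : a ∈ R → a ∉ Q := fun ha => Finset.disjoint_left.1 h ha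
      have : a ∈ B → a ∈ R := fun ha => hs.1 ha
      have : a ∈ A → a ∈ Q := fun ha => hs.2.1 ha
      simp only [Finset.mem_inter, Finset.mem_union]
      tauto
    simp [h1, h2]
  · intro A hA
    have hA1 := Finset.mem_powerset.1 (Finset.mem_filter.1 hA).1
    change A ∩ R ∪ A ∩ Q = A
    rw [← Finset.inter_union_distrib_left, Finset.inter_eq_left.2 hA1]

/-! ### Sign patterns as sets of primes. -/

/-- The completely multiplicative function with value `-1` at the primes in `A` and `1` at the
other primes. -/
noncomputable def signFun (A : Finset ℕ) : ℕ →*₀ ℝ where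
  toFun n := if n = 0 then 0 else ∏ p ∈ A, (-1) ^ n.factorization p
  map_zero' := by simp
  map_one' := by simp
  map_mul' a b := by
    rcases eq_or_ne a 0 with rfl | ha
    · simp
    rcases eq_or_ne b 0 with rfl | hb
    · simp
    simp [ha, hb, Nat.factorization_mul, pow_add, Finset.prod_mul_distrib]

theorem signFun_apply (A : Finset ℕ) {n : ℕ} (hn : n ≠ 0) :
    signFun A n = ∏ p ∈ A, (-1) ^ n.factorization p :=
  if_neg hn

theorem signFun_insert {A : Finset ℕ} {q : ℕ} (hq : q ∉ A) {n : ℕ} (hn : n ≠ 0) :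
    signFun (insert q A) n = (-1) ^ n.factorization q * signFun A n := by
  rw [signFun_apply _ hn, signFun_apply _ hn, Finset.prod_insert hq]

theorem abs_signFun_le_one (A : Finset ℕ) (n : ℕ) : |signFun A n| ≤ 1 := by
  rcases eq_or_ne n 0 with rfl | hn
  · simp
  · rw [signFun_apply _ hn, Finset.abs_prod]
    simp

theorem signFun_prime (A : Finset ℕ) {p : ℕ} (hp : p.Prime) :
    signFun A p = if p ∈ A then -1 else 1 := by
  rw [signFun_apply _ hp.ne_zero, hp.factorization]
  split_ifs with h
  · rw [Finset.prod_eq_single_of_mem p h]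
    · simp
    · intro q _ hq
      simp [hq.symm]
  · refine Finset.prod_eq_one fun q hq => ?_
    have : p ≠ q := fun e => h (e ▸ hq)
    simp [this]

theorem monoidWithZeroHom_ext_prime {f g : ℕ →*₀ ℝ} (h : ∀ p : ℕ, p.Prime → f p = g p) :
    f = g := by
  ext n
  induction n using Nat.recOnMul with
  | zero => simp
  | one => simp
  | prime p hp => exact h p hp
  | mul a b ha hb =>
    rcases Nat.eq_zero_or_pos a with rfl | ha'
    · simp
    rcases Nat.eq_zero_or_pos b with rfl | hb'
    · simp
    rw [map_mul, map_mul, ha ha', hb hb']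

theorem signFun_injOn (X : ℕ) : Set.InjOn signFun ((Nat.primesLE X).powerset : Set (Finset ℕ)) := by
  intro A hA B hB h
  have hA := Finset.mem_powerset.1 hA
  have hB := Finset.mem_powerset.1 hB
  ext p
  by_cases hp : p.Prime
  · have h' : signFun A p = signFun B p := by rw [h]
    rw [signFun_prime A hp, signFun_prime B hp] at h'
    by_cases h1 : p ∈ A <;> by_cases h2 : p ∈ B <;> simp [h1, h2] at h' ⊢ <;> norm_num at h'
  · exact iff_of_false (fun h => hp (Nat.mem_primesLE.1 (hA h)).2)
      fun h => hp (Nat.mem_primesLE.1 (hB h)).2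

theorem multSpace_eq_image {x : ℝ} (hx : 0 ≤ x) :
    multSpace x = signFun '' ((Nat.primesLE ⌊x⌋₊).powerset : Set (Finset ℕ)) := by
  classical
  ext f
  constructor
  · rintro ⟨h1, h2⟩
    refine ⟨(Nat.primesLE ⌊x⌋₊).filter fun p => f p = -1,
      Finset.mem_powerset.2 (Finset.filter_subset _ _), ?_⟩
    refine monoidWithZeroHom_ext_prime fun p hp => ?_
    rw [signFun_prime _ hp]
    rcases le_or_gt (p : ℝ) x with h | h
    · have : p ≤ ⌊x⌋₊ := Nat.le_floor h
      rcases h1 p hp h with h | h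
      · simp only [Finset.mem_filter, h]
        norm_num
      · simp [h, Nat.mem_primesLE, hp, this]
    · have : ¬ p ≤ ⌊x⌋₊ := fun h' => absurd ((Nat.le_floor_iff hx).1 h') (not_le.2 h)
      simp [h2 p hp h, Nat.mem_primesLE, this]
  · rintro ⟨A, hA, rfl⟩
    have hA := Finset.mem_powerset.1 hA
    refine ⟨fun p hp _ => ?_, fun p hp h => ?_⟩
    · rw [signFun_prime A hp]
      split_ifs <;> simp
    · rw [signFun_prime A hp, if_neg]
      exact fun h' => absurd ((Nat.le_floor_iff hx).1 (Nat.mem_primesLE.1 (hA h')).1) (not_le.2 h)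

theorem proportion_eq {x : ℝ} (hx : 0 ≤ x) (P : (ℕ →*₀ ℝ) → Prop)
    [DecidablePred fun A => P (signFun A)] :
    proportion x P = (((Nat.primesLE ⌊x⌋₊).powerset.filter fun A => P (signFun A)).card : ℝ) /
      2 ^ (Nat.primesLE ⌊x⌋₊).card := by
  have h1 : (multSpace x).ncard = 2 ^ (Nat.primesLE ⌊x⌋₊).card := by
    rw [multSpace_eq_image hx, (signFun_injOn _).ncard_image, Set.ncard_coe_finset,
      Finset.card_powerset]
  have h2 : {f ∈ multSpace x | P f}.ncard =
      ((Nat.primesLE ⌊x⌋₊).powerset.filter fun A => P (signFun A)).card := by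
    rw [← Set.ncard_coe_finset, ← ((signFun_injOn ⌊x⌋₊).mono
      (Finset.coe_subset.2 (Finset.filter_subset _ _))).ncard_image]
    congr 1
    ext f
    rw [multSpace_eq_image hx]
    constructor
    · rintro ⟨⟨A, hA, rfl⟩, hP⟩
      exact ⟨A, Finset.mem_filter.2 ⟨hA, hP⟩, rfl⟩
    · rintro ⟨A, hA, rfl⟩
      exact ⟨⟨A, (Finset.mem_filter.1 hA).1, rfl⟩, (Finset.mem_filter.1 hA).2⟩
  rw [proportion, h1, h2]
  push_cast
  rfl

/-! ### Increments and conditional mean of the sum. -/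

theorem card_filter_dvd_le {x : ℝ} (hx : 0 ≤ x) (k : ℕ) :
    (((Finset.Icc 1 ⌊x⌋₊).filter (k ∣ ·)).card : ℝ) ≤ x / k := by
  rw [show Finset.Icc 1 ⌊x⌋₊ = Finset.Ioc 0 ⌊x⌋₊ from rfl, Nat.Ioc_filter_dvd_card_eq_div]
  refine Nat.cast_div_le.trans ?_
  gcongr
  exact Nat.floor_le hx

/-- Only the at most `x / p` multiples of `p` are affected, each by at most 2 because the weights
lie in `[0, 1)`. -/
theorem abs_fracSum_insert_sub_le {x : ℝ} (hx : 0 ≤ x) {A : Finset ℕ} {p : ℕ} (hp : p ∉ A) :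
    |fracSum x (signFun (insert p A)) - fracSum x (signFun A)| ≤ 2 * (x / p) := by
  rw [fracSum, fracSum, ← Finset.sum_sub_distrib]
  calc _ ≤ ∑ n ∈ Finset.Icc 1 ⌊x⌋₊, if p ∣ n then (2 : ℝ) else 0 := by
        refine (Finset.abs_sum_le_sum_abs _ _).trans (Finset.sum_le_sum fun n hn => ?_)
        have hn0 : n ≠ 0 := Nat.one_le_iff_ne_zero.1 (Finset.mem_Icc.1 hn).1
        rw [← mul_sub, abs_mul, abs_of_nonneg (Int.fract_nonneg _), signFun_insert hp hn0]
        have hf := abs_signFun_le_one A n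
        split_ifs with h
        · have h1 : |(-1) ^ n.factorization p * signFun A n - signFun A n| ≤ 2 := by
            refine (abs_sub _ _).trans ?_
            rw [abs_mul, abs_pow, abs_neg, abs_one, one_pow]
            linarith
          have h2 := (Int.fract_lt_one (x / (n : ℝ))).le
          have h3 := Int.fract_nonneg (x / (n : ℝ))
          nlinarith [abs_nonneg ((-1) ^ n.factorization p * signFun A n - signFun A n)]
        · rw [Nat.factorization_eq_zero_of_not_dvd h]
          simp
    _ = 2 * (((Finset.Icc 1 ⌊x⌋₊).filter (p ∣ ·)).card : ℝ) := by
        rw [← Finset.sum_filter, Finset.sum_const, nsmul_eq_mul, mul_comm]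
    _ ≤ _ := by
        gcongr
        exact card_filter_dvd_le hx p

/-- Flipping the sign at `q` negates the value at `n`, so the sets with and without `q` cancel in
pairs. -/
theorem sum_powerset_signFun_union_eq_zero {B Q : Finset ℕ} (h : Disjoint B Q) {n q : ℕ}
    (hn : n ≠ 0) (hq : q ∈ Q) (hodd : Odd (n.factorization q)) :
    ∑ A ∈ Q.powerset, signFun (B ∪ A) n = 0 := by
  rw [← Finset.insert_erase hq, Finset.sum_powerset_insert (Finset.notMem_erase q Q),
    ← Finset.sum_add_distrib]
  refine Finset.sum_eq_zero fun A hA => ?_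
  have hA := Finset.mem_powerset.1 hA
  have hqA : q ∉ B ∪ A := by
    rw [Finset.mem_union, not_or]
    exact ⟨fun hB => Finset.disjoint_left.1 h hB hq,
      fun h' => Finset.notMem_erase q Q (hA h')⟩
  rw [Finset.union_insert, signFun_insert hqA hn, hodd.neg_one_pow]
  ring

theorem abs_sum_powerset_fracSum_le {B Q : Finset ℕ} (h : Disjoint B Q) (x : ℝ) :
    |∑ A ∈ Q.powerset, fracSum x (signFun (B ∪ A))| ≤ 2 ^ Q.card *
      (((Finset.Icc 1 ⌊x⌋₊).filter fun n => ∀ q ∈ Q, Even (n.factorization q)).card : ℝ) := by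
  simp only [fracSum]
  rw [Finset.sum_comm, Finset.card_eq_sum_ones (Finset.filter _ _), Nat.cast_sum, Finset.mul_sum, Finset.sum_filter]
  refine (Finset.abs_sum_le_sum_abs _ _).trans (Finset.sum_le_sum fun n hn => ?_)
  have hn0 : n ≠ 0 := by
    have := (Finset.mem_Icc.1 hn).1
    omega
  rw [← Finset.mul_sum]
  split_ifs with hev
  · rw [abs_mul, abs_of_nonneg (Int.fract_nonneg _)]
    have h1 : |∑ A ∈ Q.powerset, signFun (B ∪ A) n| ≤ 2 ^ Q.card := by
      refine (Finset.abs_sum_le_sum_abs _ _).trans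
        ((Finset.sum_le_sum fun A _ => abs_signFun_le_one (B ∪ A) n).trans_eq ?_)
      simp
    have h2 := (Int.fract_lt_one (x / (n : ℝ))).le
    have h3 := abs_nonneg (∑ A ∈ Q.powerset, signFun (B ∪ A) n)
    rw [Nat.cast_one, mul_one]
    nlinarith
  · push Not at hev
    obtain ⟨q, hq, hodd⟩ := hev
    rw [sum_powerset_signFun_union_eq_zero h hn0 hq (Nat.not_even_iff_odd.1 hodd)]
    simp

theorem sum_primesLE_filter_inv_sq_le (X n : ℕ) :
    ∑ p ∈ (Nat.primesLE X).filter (¬ · ≤ n), ((p : ℝ) ^ 2)⁻¹ ≤ 2 / (n + 1) := by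
  refine le_trans (Finset.sum_le_sum_of_subset_of_nonneg ?_ fun _ _ _ => by positivity)
    (sum_Ioo_inv_sq_le n (X + 1))
  intro p hp
  obtain ⟨h1, h2⟩ := Finset.mem_filter.1 hp
  exact Finset.mem_Ioo.2 ⟨not_le.1 h2, Nat.lt_succ_of_le (Nat.mem_primesLE.1 h1).1⟩

/-- A prime factor `q > n` that occurs to an even power occurs at least twice, so `q ^ 2` divides
the integer. The shift in `smoothNumbers (n + 1)` is there because that set requires prime factors
strictly below its index. -/
theorem card_filter_even_factorization_le {x : ℝ} (hx : 0 ≤ x) (n : ℕ) :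
    (((Finset.Icc 1 ⌊x⌋₊).filter fun k => ∀ q ∈ (Nat.primesLE ⌊x⌋₊).filter (¬ · ≤ n),
        Even (k.factorization q)).card : ℝ) ≤
      (((Finset.Icc 1 ⌊x⌋₊).filter (· ∈ Nat.smoothNumbers (n + 1))).card : ℝ) +
        2 * x / (n + 1) := by
  set Q := (Nat.primesLE ⌊x⌋₊).filter (¬ · ≤ n)
  have hsub : ((Finset.Icc 1 ⌊x⌋₊).filter fun k => ∀ q ∈ Q, Even (k.factorization q)) ⊆
      (Finset.Icc 1 ⌊x⌋₊).filter (· ∈ Nat.smoothNumbers (n + 1)) ∪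
        Q.biUnion fun q => (Finset.Icc 1 ⌊x⌋₊).filter (q ^ 2 ∣ ·) := by
    intro k hk
    obtain ⟨hk1, hk2⟩ := Finset.mem_filter.1 hk
    obtain ⟨h1, hkX⟩ := Finset.mem_Icc.1 hk1
    have hk0 : k ≠ 0 := by omega
    rw [Finset.mem_union]
    by_cases hs : k ∈ Nat.smoothNumbers (n + 1)
    · exact Or.inl (Finset.mem_filter.2 ⟨hk1, hs⟩)
    · right
      rw [Nat.mem_smoothNumbers'] at hs
      push Not at hs
      obtain ⟨p, hp, hpk, hnp⟩ := hs
      have hpQ : p ∈ Q := Finset.mem_filter.2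
        ⟨Nat.mem_primesLE.2 ⟨(Nat.le_of_dvd h1 hpk).trans hkX, hp⟩, by omega⟩
      refine Finset.mem_biUnion.2 ⟨p, hpQ, Finset.mem_filter.2 ⟨hk1, ?_⟩⟩
      rw [hp.pow_dvd_iff_le_factorization hk0]
      have hpos := hp.factorization_pos_of_dvd hk0 hpk
      obtain ⟨r, hr⟩ := hk2 p hpQ
      omega
  have hcard : (((Finset.Icc 1 ⌊x⌋₊).filter fun k => ∀ q ∈ Q, Even (k.factorization q)).card : ℝ) ≤
      (((Finset.Icc 1 ⌊x⌋₊).filter (· ∈ Nat.smoothNumbers (n + 1))).card : ℝ) +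
        ∑ q ∈ Q, (((Finset.Icc 1 ⌊x⌋₊).filter (q ^ 2 ∣ ·)).card : ℝ) := by
    exact_mod_cast (Finset.card_le_card hsub).trans ((Finset.card_union_le _ _).trans
      (Nat.add_le_add_left Finset.card_biUnion_le _))
  refine hcard.trans (add_le_add_right ?_ _)
  calc ∑ q ∈ Q, (((Finset.Icc 1 ⌊x⌋₊).filter (q ^ 2 ∣ ·)).card : ℝ)
      ≤ ∑ q ∈ Q, x * ((q : ℝ) ^ 2)⁻¹ := by
        refine Finset.sum_le_sum fun q _ => ?_
        have := card_filter_dvd_le hx (q ^ 2)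
        push_cast at this
        rwa [div_eq_mul_inv] at this
    _ = x * ∑ q ∈ Q, ((q : ℝ) ^ 2)⁻¹ := (Finset.mul_sum _ _ _).symm
    _ ≤ x * (2 / (n + 1)) := by
        gcongr
        exact sum_primesLE_filter_inv_sq_le _ _
    _ = _ := by ring

/-! ### Concentration and choice of parameters. -/

/-- Concentration of `fracSum`, from the randomness of the signs at the primes above `n`. -/
theorem proportion_le {x : ℝ} (hx : 0 < x) (n : ℕ) {m t : ℝ} (ht : 0 ≤ t)
    (hm : (((Finset.Icc 1 ⌊x⌋₊).filter (· ∈ Nat.smoothNumbers (n + 1))).card : ℝ) +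
      2 * x / (n + 1) ≤ m) :
    proportion x (fun f => m + t ≤ |fracSum x f|) ≤
      2 * Real.exp (-(t ^ 2 * (n + 1) / (4 * x ^ 2))) := by
  classical
  rw [proportion_eq hx.le, div_le_iff₀' (by positivity)]
  set R := (Nat.primesLE ⌊x⌋₊).filter (· ≤ n)
  set Q := (Nat.primesLE ⌊x⌋₊).filter (¬ · ≤ n)
  have hRQ : R ∪ Q = Nat.primesLE ⌊x⌋₊ := Finset.filter_union_filter_not_eq _ _
  have hdis : Disjoint R Q := Finset.disjoint_filter_filter_not _ _ _
  have hD : 2 * x ^ 2 / ((n : ℝ) + 1) > 0 := by positivity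
  have hdD : ∑ p ∈ Q, (x / p) ^ 2 ≤ 2 * x ^ 2 / ((n : ℝ) + 1) := by
    have h1 : ∀ p ∈ Q, (x / p) ^ 2 = x ^ 2 * ((p : ℝ) ^ 2)⁻¹ := fun p _ => by
      rw [div_pow, div_eq_mul_inv]
    rw [Finset.sum_congr rfl h1, ← Finset.mul_sum]
    calc _ ≤ x ^ 2 * (2 / ((n : ℝ) + 1)) := by
          gcongr
          exact sum_primesLE_filter_inv_sq_le _ _
      _ = _ := by ring
  have hexp : t ^ 2 * (n + 1) / (4 * x ^ 2) = t ^ 2 / (2 * (2 * x ^ 2 / ((n : ℝ) + 1))) := by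
    field_simp
    norm_num
  -- The bound is uniform in the signs `B` at the small primes, so summing over `B` loses nothing.
  have hB : ∀ B ∈ R.powerset,
      ((Q.powerset.filter fun A => m + t ≤ |fracSum x (signFun (B ∪ A))|).card : ℝ) ≤
        2 ^ Q.card * (2 * Real.exp (-(t ^ 2 * (n + 1) / (4 * x ^ 2)))) := by
    intro B hB
    have hBQ : Disjoint B Q := Finset.disjoint_of_subset_left (Finset.mem_powerset.1 hB) hdis
    rw [hexp]
    refine card_filter_powerset_abs_le Q (fun p => x / p) (fun A => fracSum x (signFun (B ∪ A)))
      (fun p hp A _ hpA => ?_) hD hdD ht ?_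
    · rw [Finset.union_insert]
      refine abs_fracSum_insert_sub_le hx.le ?_
      rw [Finset.mem_union, not_or]
      exact ⟨fun h => Finset.disjoint_left.1 hBQ h hp, hpA⟩
    · refine (abs_sum_powerset_fracSum_le hBQ x).trans ?_
      gcongr
      exact (card_filter_even_factorization_le hx.le n).trans hm
  rw [← hRQ, card_filter_powerset_union hdis, Nat.cast_sum]
  refine (Finset.sum_le_sum hB).trans_eq ?_
  rw [Finset.sum_const, Finset.card_powerset, nsmul_eq_mul, Finset.card_union_of_disjoint hdis,
    pow_add]
  push_cast
  ring

theorem proportion_mono (x : ℝ) {P P' : (ℕ →*₀ ℝ) → Prop} (h : ∀ f, P f → P' f) :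
    proportion x P ≤ proportion x P' := by
  have hsub : {f ∈ multSpace x | P f} ⊆ {f ∈ multSpace x | P' f} := fun f hf => ⟨hf.1, h f hf.2⟩
  have hfin : {f ∈ multSpace x | P' f}.Finite := (multSpace_finite x).subset fun f hf => hf.1
  exact div_le_div_of_nonneg_right (Nat.cast_le.2 (Set.ncard_le_ncard hsub hfin))
    (Nat.cast_nonneg _)

theorem eventually_iterated_log_bounds (b : ℝ) :
    ∀ᶠ x : ℝ in Filter.atTop, Real.exp 1 ≤ x ∧ b ≤ Real.log x ∧
      1 ≤ Real.log (Real.log (Real.log x)) ∧ 160 * Real.log (Real.log x) ≤ Real.log x ∧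
      1280 * Real.log (Real.log x) ^ 2 ≤ Real.log x := by
  have hT := Real.tendsto_log_atTop
  have h1 := (hT.comp (hT.comp hT)).eventually_ge_atTop 1
  have h2 := (hT.comp hT).eventually_ge_atTop 1
  have h3 := hT.eventually ((Real.isLittleO_pow_log_id_atTop (n := 2)).bound
    (show (0 : ℝ) < 1 / 1280 by norm_num))
  filter_upwards [h1, h2, h3, Filter.eventually_ge_atTop (Real.exp 1), hT.eventually_ge_atTop b,
    hT.eventually_ge_atTop 0] with x h1 h2 h3 h4 h5 h6
  simp only [Function.comp_apply] at h1 h2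
  have h7 : 1280 * Real.log (Real.log x) ^ 2 ≤ Real.log x := by
    rw [Real.norm_of_nonneg (by positivity), id, Real.norm_of_nonneg h6] at h3
    linarith
  exact ⟨h4, h5, h1, by nlinarith, h7⟩

theorem corollary5p1 :
    ∀ c : ℝ, 0 < c → ∃ C : ℝ, 0 < C ∧ ∃ x₀ : ℝ, ∀ x : ℝ, x₀ ≤ x → ∀ M : ℝ, c ≤ M →
      proportion x (fun f => M / Real.log x * x ≤ |fracSum x f|) ≤
        Real.exp (-Real.exp (Real.log (Real.log (Real.log x)) * Real.log x /
          (C * Real.log (Real.log x)))) := by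
  intro c hc
  obtain ⟨x₀, hx₀⟩ := Filter.eventually_atTop.1
    (eventually_iterated_log_bounds (max 1 (max (6 / c) (32 / c ^ 2))))
  refine ⟨320, by norm_num, x₀, fun x hx M hM => ?_⟩
  obtain ⟨hxe, hb, h3, h160, h1280⟩ := hx₀ x hx
  have hx0 : 0 < x := (Real.exp_pos 1).trans_le hxe
  simp only [max_le_iff] at hb
  obtain ⟨hL, hb1, hb2⟩ := hb
  have hsm := fun n : ℕ => card_smoothNumbers_le_div_log_pow (n := n) hxe h3 h160
  set L := Real.log x with hLdef
  have hL0 : 0 < L := by linarith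
  set L2 := Real.log L with hL2def
  set L3 := Real.log L2 with hL3def
  have hL2 : 0 < L2 := by
    rcases (Real.log_nonneg hL).eq_or_lt with h | h
    · rw [hL3def, hL2def, ← h, Real.log_zero] at h3; linarith
    · exact h
  -- The cutoff is `n = ⌊z ^ 2⌋`, the largest that the smooth-number bound allows. The spare factor
  -- `z` absorbs `L ^ 2` and the constants, and this turns 160 into `C = 320`.
  set z := Real.exp (L3 * L / (320 * L2)) with hz
  have hzz : z ^ 2 = Real.exp (L3 * L / (160 * L2)) := by
    rw [hz, ← Real.exp_nat_mul]
    congr 1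
    field_simp
    norm_num
  -- Taking logarithms, this is `4 * 320 * L2 ^ 2 ≤ L3 * L`, which follows from `1280 * L2 ^ 2 ≤ L`
  -- and `L3 ≥ 1`.
  have hzL : L ^ 4 ≤ z := by
    rw [← Real.exp_log (pow_pos hL0 4), Real.log_pow, hz]
    refine Real.exp_le_exp.2 ?_
    rw [le_div_iff₀ (by positivity)]
    push_cast
    rw [← hL2def]
    nlinarith
  have hL4 : 1 ≤ L ^ 4 := one_le_pow₀ hL
  have hz1 : 1 ≤ z := hL4.trans hzL
  set n := ⌊z ^ 2⌋₊ with hn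
  have hn1 : 1 ≤ n := Nat.le_floor (by push_cast; nlinarith)
  have hnz : (n : ℝ) ≤ z ^ 2 := Nat.floor_le (by positivity)
  have hnz' : z ^ 2 ≤ n + 1 := (Nat.lt_floor_add_one _).le
  have hm : (((Finset.Icc 1 ⌊x⌋₊).filter (· ∈ Nat.smoothNumbers (n + 1))).card : ℝ) +
      2 * x / (n + 1) ≤ c * x / (2 * L) := by
    have h1 := hsm n hn1 (hzz ▸ hnz)
    have h2 : 2 * x / (n + 1) ≤ 2 * x / L ^ 4 := by
      gcongr
      nlinarith
    have h4 : 3 * x / L ^ 4 ≤ c * x / (2 * L) := by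
      rw [div_le_div_iff₀ (by positivity) (by positivity)]
      have h5 : 6 ≤ L * c := (div_le_iff₀ hc).1 hb1
      have h6 : L ≤ L ^ 3 := le_self_pow₀ hL (by norm_num)
      have h7 : 6 ≤ L ^ 3 * c := h5.trans (by gcongr)
      calc 3 * x * (2 * L) = x * L * 6 := by ring
        _ ≤ x * L * (L ^ 3 * c) := by gcongr
        _ = _ := by ring
    have h8 : x / L ^ 4 + 2 * x / L ^ 4 = 3 * x / L ^ 4 := by ring
    linarith
  -- Since `M ≥ c`, the threshold can be lowered to `c * x / L`, split equally between mean and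
  -- deviation.
  have hmono := proportion_mono x (P := fun f => M / L * x ≤ |fracSum x f|)
    (P' := fun f => c * x / (2 * L) + c * x / (2 * L) ≤ |fracSum x f|) fun f hf => by
      refine le_trans ?_ hf
      have : c / L * x ≤ M / L * x := by gcongr
      refine le_trans (le_of_eq ?_) this
      field_simp
      norm_num
  refine hmono.trans ((proportion_le hx0 n (by positivity) hm).trans ?_)
  have hkey : 2 * z ≤ (c * x / (2 * L)) ^ 2 * (n + 1) / (4 * x ^ 2) := by
    have h1 : 32 ≤ L * c ^ 2 := (div_le_iff₀ (by positivity)).1 hb2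
    have h2 : 32 * L ^ 2 ≤ c ^ 2 * z := by
      have h6 : L ≤ L ^ 2 := le_self_pow₀ hL (by norm_num)
      calc 32 * L ^ 2 ≤ L * c ^ 2 * L ^ 2 := by gcongr
        _ ≤ L ^ 2 * c ^ 2 * L ^ 2 := by gcongr
        _ = c ^ 2 * L ^ 4 := by ring
        _ ≤ _ := by gcongr
    have h3 : (c * x / (2 * L)) ^ 2 * (n + 1) / (4 * x ^ 2) = c ^ 2 * (n + 1) / (16 * L ^ 2) := by
      field_simp
      norm_num
    rw [h3, le_div_iff₀ (by positivity)]
    calc 2 * z * (16 * L ^ 2) = 32 * L ^ 2 * z := by ring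
      _ ≤ c ^ 2 * z * z := by gcongr
      _ = c ^ 2 * z ^ 2 := by ring
      _ ≤ _ := by gcongr
  -- The two-sided factor 2 is at most `exp 1`, and `1 ≤ z` absorbs it.
  calc 2 * Real.exp (-((c * x / (2 * L)) ^ 2 * (n + 1) / (4 * x ^ 2)))
      ≤ Real.exp 1 * Real.exp (-(2 * z)) := by
        gcongr
        linarith [Real.add_one_le_exp (1 : ℝ)]
    _ = Real.exp (1 - 2 * z) := by rw [← Real.exp_add]; ring_nf
    _ ≤ Real.exp (-z) := Real.exp_le_exp.2 (by linarith)
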